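/- Let $w \ge 6$ be an even integer. A quasimodular form of weight $w$ and depth $s$ (of level $\mathrm{SL}_2(\mathbb Z)$) is a holomorphic function $F$ on the upper half-plane for which there are holomorphic functions $F_0,\dots,F_s$ on the upper half-plane, bounded as $\operatorname{Im} z\to\infty$, with $F_s\not\equiv 0$, such that $$(cz+d)^{-w}F\Big(\frac{az+b}{cz+d}\Big)=\sum_{r=0}^{s}F_r(z)\Big(\frac{c}{cz+d}\Big)^r\qquad\text{for all }\begin{pmatrix}a&b\\c&d\end{pmatrix}\in\mathrm{SL}_2(\mathbb Z).$$ Such an $F$ has an expansion $F=\sum_{n\ge0}a_nq^n$, $q=e^{2\pi i z}$, and its vanishing order at infinity is the least $n$ with $a_n\ne0$. Let $X_{w,1}$ be the normalized extremal quasimodular form of weight $w$ and depth $1$, i.e. one whose vanishing order at infinity is the highest among all quasimodular forms of weight $w$ and depth $1$, and whose first nonzero coefficient is $1$. Write $F'=\frac{1}{2\pi i}\frac{dF}{dz}$. Then $$\lim_{t\to0^+}\frac{X_{w,1}(it)}{t\,X_{w,1}'(it)}=\frac{2\pi}{w-1}.$$ Moreover, $X_{w,1}$ can be written as $X_{w,1}=A_w+E_2B_{w-2}$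 with $A_w$ and $B_{w-2}$ modular forms for $\mathrm{SL}_2(\mathbb Z)$ of weights $w$ and $w-2$, where $E_2=1-24\sum_{n\ge1}\big(\sum_{d\mid n}d\big)q^n$, and for every such decomposition $$\lim_{t\to0^+}t^{w-1}X_{w,1}(it)=-\frac{6(-1)^{w/2}\beta_{w-2}}{\pi},$$ where $\beta_{w-2}$ is the constant term of the $q$-expansion of $B_{w-2}$. -/

import Mathlib

open UpperHalfPlane Filter Topology
open scoped MatrixGroups ModularForm Manifold

/-- `IsQuasimodularForm w s F`: the function `F` on the upper half-plane is a quasimodular form of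
level `SL(2, ℤ)`, weight `w` and depth exactly `s`. That is, `F` is holomorphic and there are
holomorphic functions `F₀, …, Fₛ`, bounded at infinity, with `Fₛ ≠ 0`, such that
`(c z + d) ^ (-w) F ((a z + b) / (c z + d)) = ∑ r ≤ s, F_r(z) (c / (c z + d)) ^ r`
for all `(a, b; c, d) ∈ SL(2, ℤ)` and all `z`. -/
def IsQuasimodularForm (w : ℤ) (s : ℕ) (F : ℍ → ℂ) : Prop :=
  MDifferentiable 𝓘(ℂ) 𝓘(ℂ) F ∧
  ∃ f : Fin (s + 1) → ℍ → ℂ,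
    (∀ r, MDifferentiable 𝓘(ℂ) 𝓘(ℂ) (f r)) ∧
    (∀ r, IsBoundedAtImInfty (f r)) ∧
    f (Fin.last s) ≠ 0 ∧
    ∀ (γ : SL(2, ℤ)) (z : ℍ),
      (F ∣[w] γ) z = ∑ r : Fin (s + 1), f r z * (((γ 1 0 : ℤ) : ℂ) / denom γ z) ^ (r : ℕ)

/-- The order of vanishing at infinity of a `1`-periodic function on the upper half-plane: the
least exponent with a nonzero coefficient in its `q`-expansion, `q = exp (2 π i z)`. -/
noncomputable def vanishingOrder (F : ℍ → ℂ) : ℕ∞ := (qExpansion 1 F).order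

/-- `F` is an extremal quasimodular form of weight `w` and depth `s`: it has the highest order of
vanishing at infinity among all quasimodular forms of level `SL(2, ℤ)`, weight `w` and
depth `s`. -/
def IsExtremalQuasimodularForm (w : ℤ) (s : ℕ) (F : ℍ → ℂ) : Prop :=
  IsQuasimodularForm w s F ∧
  ∀ G : ℍ → ℂ, IsQuasimodularForm w s G → vanishingOrder G ≤ vanishingOrder F

/-- An extremal quasimodular form is normalized if the first nonzero coefficient of its
`q`-expansion is `1`. -/
def IsNormalizedExtremalQuasimodularForm (w : ℤ) (s : ℕ) (F : ℍ → ℂ) : Prop :=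
  IsExtremalQuasimodularForm w s F ∧
  ∃ n : ℕ, vanishingOrder F = n ∧ (qExpansion 1 F).coeff n = 1

/-! ### Periodic holomorphic functions at the cusp and their derivatives -/

section HolomorphicAtCusp

open Derivative

/-! Write X = A + E₂B and κ = 6/(πi). The law of E₂ gives X(-1/z) = z^w (X(z) + κB(z)/z). At z = iy
with y = 1/t → ∞, X(iy) decays exponentially once X vanishes at the cusp, so the B-term governs both
X(it) and, after differentiation, X'(it). The limits follow, the quotient one only if B has nonzero
constant term.

That nonvanishing is where extremality enters. Let n and b be the orders of X and B. The combination
X² + 12(XB' - BX') is modular of weight 2w and has order exactly n + b when b < n, so the Sturm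
bound gives n + b ≤ ⌊w/6⌋ (`order_add_order_le`). A dimension count gives n ≥ ⌊w/6⌋
(`exists_isQuasimodularForm_le_vanishingOrder`). Hence b = 0. -/

/-- A holomorphic function on the upper half-plane that is `1`-periodic and bounded at infinity. -/
structure IsHolomorphicAtCusp (f : ℍ → ℂ) : Prop where
  holo : MDifferentiable 𝓘(ℂ) 𝓘(ℂ) f
  periodic : Function.Periodic (f ∘ ofComplex) 1
  bdd : IsBoundedAtImInfty f

theorem periodic_comp_ofComplex_iff {f : ℍ → ℂ} :
    Function.Periodic (f ∘ ofComplex) 1 ↔ ∀ z : ℍ, f ((1 : ℝ) +ᵥ z) = f z := by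
  have key (z : ℍ) : f (ofComplex ((z : ℂ) + 1)) = f ((1 : ℝ) +ᵥ z) := by
    rw [← ofComplex_apply ((1 : ℝ) +ᵥ z), coe_vadd, Complex.ofReal_one, add_comm]
  refine ⟨fun h z ↦ ?_, fun h w ↦ ?_⟩
  · simpa [key] using h z
  · by_cases hw : 0 < w.im
    · have := key ⟨w, hw⟩
      simp only [Function.comp_apply]
      rw [show w = ((⟨w, hw⟩ : ℍ) : ℂ) from rfl, this, h, ofComplex_apply]
    -- Off the half-plane `ofComplex` takes a constant value, so periodicity is automatic there.
    · have hw' : (w + 1).im ≤ 0 := by simpa using hw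
      simp [ofComplex_apply_of_im_nonpos hw', ofComplex_apply_of_im_nonpos (not_lt.mp hw)]

theorem periodic_comp_ofComplex_of_slash_T {f : ℍ → ℂ} {k : ℤ}
    (h : f ∣[k] ModularGroup.T = f) : Function.Periodic (f ∘ ofComplex) 1 := by
  refine periodic_comp_ofComplex_iff.mpr fun z ↦ ?_
  have := congrFun h z
  rw [ModularForm.SL_slash_apply, modular_T_smul, ModularGroup.denom_apply] at this
  simpa [ModularGroup.T] using this

namespace IsHolomorphicAtCusp

variable {f g : ℍ → ℂ}

theorem analyticAt (hf : IsHolomorphicAtCusp f) : AnalyticAt ℂ (cuspFunction 1 f) 0 :=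
  analyticAt_cuspFunction_zero one_pos (mod_cast hf.periodic) hf.holo hf.bdd

theorem eq_cuspFunction (hf : IsHolomorphicAtCusp f) (z : ℍ) :
    cuspFunction 1 f (Function.Periodic.qParam 1 z) = f z :=
  UpperHalfPlane.eq_cuspFunction z one_ne_zero (mod_cast hf.periodic)

theorem tendsto_atImInfty (hf : IsHolomorphicAtCusp f) :
    Tendsto f atImInfty (𝓝 ((qExpansion 1 f).coeff 0)) := by
  have h := hf.analyticAt.continuousAt.tendsto.comp (qParam_tendsto_atImInfty one_pos)
  have h0 : (qExpansion 1 f).coeff 0 = cuspFunction 1 f 0 := by simp [qExpansion_coeff]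
  rw [h0]
  exact h.congr hf.eq_cuspFunction

theorem add (hf : IsHolomorphicAtCusp f) (hg : IsHolomorphicAtCusp g) :
    IsHolomorphicAtCusp (f + g) :=
  ⟨hf.holo.add hg.holo, fun z ↦ congrArg₂ (· + ·) (hf.periodic z) (hg.periodic z),
    hf.bdd.add hg.bdd⟩

theorem sub (hf : IsHolomorphicAtCusp f) (hg : IsHolomorphicAtCusp g) :
    IsHolomorphicAtCusp (f - g) :=
  ⟨hf.holo.sub hg.holo, fun z ↦ congrArg₂ (· - ·) (hf.periodic z) (hg.periodic z),
    hf.bdd.sub hg.bdd⟩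

theorem mul (hf : IsHolomorphicAtCusp f) (hg : IsHolomorphicAtCusp g) :
    IsHolomorphicAtCusp (f * g) :=
  ⟨hf.holo.mul hg.holo, fun z ↦ congrArg₂ (· * ·) (hf.periodic z) (hg.periodic z),
    hf.bdd.mul hg.bdd⟩

theorem smul (hf : IsHolomorphicAtCusp f) (c : ℂ) : IsHolomorphicAtCusp (c • f) :=
  ⟨hf.holo.const_smul c, fun z ↦ congrArg (c * ·) (hf.periodic z), hf.bdd.const_smul_left c⟩

theorem qExpansion_add (hf : IsHolomorphicAtCusp f) (hg : IsHolomorphicAtCusp g) :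
    qExpansion 1 (f + g) = qExpansion 1 f + qExpansion 1 g :=
  UpperHalfPlane.qExpansion_add hf.analyticAt hg.analyticAt

theorem qExpansion_sub (hf : IsHolomorphicAtCusp f) (hg : IsHolomorphicAtCusp g) :
    qExpansion 1 (f - g) = qExpansion 1 f - qExpansion 1 g :=
  UpperHalfPlane.qExpansion_sub hf.analyticAt hg.analyticAt

theorem qExpansion_mul (hf : IsHolomorphicAtCusp f) (hg : IsHolomorphicAtCusp g) :
    qExpansion 1 (f * g) = qExpansion 1 f * qExpansion 1 g :=
  UpperHalfPlane.qExpansion_mul hf.analyticAt hg.analyticAt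

theorem qExpansion_smul (hf : IsHolomorphicAtCusp f) (c : ℂ) :
    qExpansion 1 (c • f) = c • qExpansion 1 f :=
  UpperHalfPlane.qExpansion_smul hf.analyticAt c

/-- In terms of `q`, the operator `D` is `q d/dq`. -/
theorem normalizedDeriv_eq (hf : IsHolomorphicAtCusp f) (z : ℍ) :
    normalizedDerivOfComplex f z =
      Function.Periodic.qParam 1 z * deriv (cuspFunction 1 f) (Function.Periodic.qParam 1 z) := by
  have hq : HasDerivAt (fun w : ℂ ↦ Function.Periodic.qParam 1 w)
      (Function.Periodic.qParam 1 z * (2 * Real.pi * Complex.I)) (z : ℂ) := by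
    have := (((hasDerivAt_id (z : ℂ)).const_mul (2 * Real.pi * Complex.I)).div_const
      ((1 : ℝ) : ℂ)).cexp
    simpa [Function.Periodic.qParam] using this
  have hc : DifferentiableAt ℂ (cuspFunction 1 f) (Function.Periodic.qParam 1 z) :=
    differentiableAt_cuspFunction one_pos (mod_cast hf.periodic) hf.holo hf.bdd
      (Function.Periodic.norm_qParam_lt_one one_pos z.im_pos)
  have h := hc.hasDerivAt.comp (z : ℂ) hq
  have heq : (f ∘ ofComplex) =ᶠ[𝓝 (z : ℂ)]
      (cuspFunction 1 f ∘ fun w : ℂ ↦ Function.Periodic.qParam 1 w) := by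
    filter_upwards [isOpen_upperHalfPlaneSet.mem_nhds z.im_pos] with w hw
    have := hf.eq_cuspFunction ⟨w, hw⟩
    simp only [Function.comp_apply, ofComplex_apply_of_im_pos hw]
    exact this.symm
  rw [normalizedDerivOfComplex, heq.deriv_eq, h.deriv]
  have : (Real.pi : ℂ) ≠ 0 := mod_cast Real.pi_ne_zero
  field_simp [Complex.I_ne_zero]

theorem hasSum_normalizedDeriv (hf : IsHolomorphicAtCusp f) (z : ℍ) :
    HasSum (fun m : ℕ ↦ ((m : ℂ) * (qExpansion 1 f).coeff m) •
      Function.Periodic.qParam 1 z ^ m) (normalizedDerivOfComplex f z) := by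
  have hd : DifferentiableOn ℂ (deriv (cuspFunction 1 f)) (Metric.ball 0 1) :=
    (differentiableOn_cuspFunction_ball one_pos (mod_cast hf.periodic) hf.holo hf.bdd).deriv
      Metric.isOpen_ball
  have hq : Function.Periodic.qParam 1 (z : ℂ) ∈ Metric.ball (0 : ℂ) 1 := by
    simpa using Function.Periodic.norm_qParam_lt_one one_pos z.im_pos
  have h := (Complex.hasSum_taylorSeries_on_ball hd hq).mul_left
    (Function.Periodic.qParam 1 (z : ℂ))
  -- The term m = 0 vanishes; the factor q shifts the Taylor series of the derivative by one.
  rw [← hasSum_nat_add_iff' 1, hf.normalizedDeriv_eq]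
  convert! h using 1
  · ext m
    have : ((m : ℂ) + 1) ≠ 0 := by exact_mod_cast m.succ_ne_zero
    simp only [qExpansion_coeff, sub_zero, smul_eq_mul, iteratedDeriv_succ', pow_succ,
      Nat.factorial_succ, Nat.cast_mul, Nat.cast_add, Nat.cast_one]
    field_simp
  · simp

theorem normalizedDeriv (hf : IsHolomorphicAtCusp f) :
    IsHolomorphicAtCusp (normalizedDerivOfComplex f) where
  holo := normalizedDerivOfComplex_mdifferentiable hf.holo
  periodic := by
    refine periodic_comp_ofComplex_iff.mpr fun z ↦ ?_
    rw [hf.normalizedDeriv_eq, hf.normalizedDeriv_eq, coe_vadd, add_comm]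
    have : Function.Periodic.qParam 1 ((z : ℂ) + (1 : ℝ)) = Function.Periodic.qParam 1 z := by
      simp [Function.Periodic.qParam, mul_add, Complex.exp_add]
    rw [this]
  bdd := isBoundedAtImInfty_of_hasSum_qExpansion one_pos hf.hasSum_normalizedDeriv

theorem coeff_qExpansion_normalizedDeriv (hf : IsHolomorphicAtCusp f) (m : ℕ) :
    (qExpansion 1 (normalizedDerivOfComplex f)).coeff m = m * (qExpansion 1 f).coeff m := by
  have h1 := (hasFPowerSeriesOnBall_cuspFunction one_pos hf.normalizedDeriv.analyticAt
    hf.hasSum_normalizedDeriv).hasFPowerSeriesAt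
  have h2 := h1.eq_formalMultilinearSeries hf.normalizedDeriv.analyticAt.hasFPowerSeriesAt
  have h3 := congrArg (fun p ↦ FormalMultilinearSeries.coeff p m) h2
  simp only [FormalMultilinearSeries.coeff_ofScalars] at h3
  rw [h3, qExpansion_coeff, div_eq_inv_mul]

/-- A function vanishing at the cusp decays faster than any power along the imaginary axis. -/
theorem tendsto_pow_mul (hf : IsHolomorphicAtCusp f) (h0 : (qExpansion 1 f).coeff 0 = 0) (m : ℕ)
    {u : ℝ → ℍ} (hu : ∀ᶠ y in atTop, (u y).im = y) :
    Tendsto (fun y : ℝ ↦ (y : ℂ) ^ m * f (u y)) atTop (𝓝 0) := by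
  have hz : IsZeroAtImInfty f := by
    have := hf.tendsto_atImInfty
    rwa [h0] at this
  have huT : Tendsto u atTop atImInfty :=
    tendsto_comap_iff.mpr (tendsto_id.congr' (hu.mono fun y hy ↦ hy.symm))
  have hO := (hz.exp_decay_atImInfty one_pos (mod_cast hf.periodic) hf.holo hf.bdd).comp_tendsto huT
  have h1 : (fun y : ℝ ↦ (y : ℂ) ^ m * f (u y)) =O[atTop]
      fun y : ℝ ↦ y ^ m * Real.exp (-(2 * Real.pi) * y) := by
    refine Asymptotics.IsBigO.mul (Asymptotics.isBigO_of_le _ fun y ↦ by simp) ?_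
    refine hO.congr' EventuallyEq.rfl (hu.mono fun y hy ↦ ?_)
    simp [hy]
  refine h1.trans_tendsto ?_
  have := tendsto_rpow_mul_exp_neg_mul_atTop_nhds_zero m (2 * Real.pi) Real.two_pi_pos
  simpa using this

end IsHolomorphicAtCusp

theorem ModularForm.isHolomorphicAtCusp {k : ℤ} (f : ModularForm 𝒮ℒ k) :
    IsHolomorphicAtCusp f :=
  ⟨ModularFormClass.holo f,
    mod_cast SlashInvariantFormClass.periodic_comp_ofComplex f one_mem_strictPeriods_SL,
    ModularFormClass.bdd_at_infty f⟩

end HolomorphicAtCusp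

/-! ### Structure of quasimodular forms of depth one -/

section DepthOne

open EisensteinSeries ModularGroup

/-- A function of level one is a modular form as soon as it is invariant under `S` and `T`. -/
noncomputable def ModularForm.ofSlashGenerators {k : ℤ} (f : ℍ → ℂ)
    (holo : MDifferentiable 𝓘(ℂ) 𝓘(ℂ) f) (bdd : IsBoundedAtImInfty f)
    (hS : f ∣[k] S = f) (hT : f ∣[k] T = f) : ModularForm 𝒮ℒ k where
  toFun := f
  slash_action_eq' := by
    rintro _ ⟨γ, rfl⟩
    exact SlashInvariantForm.slash_action_generators_SL2Z hS hT γ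
  holo' := holo
  bdd_at_cusps' {c} hc := by
    rw [OnePoint.isBoundedAt_iff_forall_SL2Z hc]
    intro γ _
    rwa [SlashInvariantForm.slash_action_generators_SL2Z hS hT γ]

theorem slash_T_apply (f : ℍ → ℂ) (k : ℤ) (z : ℍ) : (f ∣[k] T) z = f (T • z) := by
  rw [ModularForm.SL_slash_apply, ModularGroup.denom_apply]
  simp [T]

theorem slash_S_apply (f : ℍ → ℂ) (k : ℤ) (z : ℍ) :
    (f ∣[k] S) z = f (S • z) * ((z : ℂ) ^ k)⁻¹ := by
  rw [ModularForm.SL_slash_apply, denom_S, zpow_neg]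

theorem slash_T_eq_of_periodic {f : ℍ → ℂ} (hf : Function.Periodic (f ∘ ofComplex) 1) (k : ℤ) :
    f ∣[k] T = f := by
  ext z
  rw [slash_T_apply, modular_T_smul]
  exact periodic_comp_ofComplex_iff.mp hf z

theorem ModularForm.slash_SL_eq {k : ℤ} (f : ModularForm 𝒮ℒ k) (γ : SL(2, ℤ)) :
    ⇑f ∣[k] γ = f :=
  SlashInvariantFormClass.slash_action_eq f _ ⟨γ, rfl⟩

/-- The constant is -2πi/(2ζ(2)) with ζ(2) = π²/6. -/
theorem E2_slash_apply (γ : SL(2, ℤ)) (z : ℍ) :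
    (E2 ∣[(2 : ℤ)] γ) z =
      E2 z + 6 / (Real.pi * Complex.I) * (((γ 1 0 : ℤ) : ℂ) / denom γ z) := by
  have hpi : (Real.pi : ℂ) ≠ 0 := mod_cast Real.pi_ne_zero
  have hd := denom_ne_zero γ z
  rw [E2_slash_action, Pi.sub_apply, Pi.smul_apply, D2, riemannZeta_two, smul_eq_mul]
  field_simp
  linear_combination (-6 * ((γ 1 0 : ℤ) : ℂ)) * Complex.I_sq

theorem isHolomorphicAtCusp_E2 : IsHolomorphicAtCusp E2 where
  holo := E2_mdifferentiable
  periodic := periodic_comp_ofComplex_of_slash_T (k := 2) <| by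
    rw [E2_slash_action, D2_T, smul_zero, sub_zero]
  bdd := isBoundedAtImInfty_E2

variable {w : ℤ}

/-- The transformation law of `A + E₂ B`. -/
theorem slash_add_E2_mul (A : ModularForm 𝒮ℒ w) (B : ModularForm 𝒮ℒ (w - 2)) (γ : SL(2, ℤ))
    (z : ℍ) :
    ((⇑A + E2 * ⇑B) ∣[w] γ) z = (⇑A + E2 * ⇑B) z +
      6 / (Real.pi * Complex.I) * B z * (((γ 1 0 : ℤ) : ℂ) / denom γ z) := by
  have h : (E2 * ⇑B) ∣[w] γ = (E2 ∣[(2 : ℤ)] γ) * (⇑B ∣[w - 2] γ) := by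
    rw [← ModularForm.mul_slash_SL2, add_sub_cancel]
  rw [SlashAction.add_slash, h, ModularForm.slash_SL_eq, ModularForm.slash_SL_eq]
  simp only [Pi.add_apply, Pi.mul_apply, E2_slash_apply]
  ring

theorem isHolomorphicAtCusp_add_E2_mul (A : ModularForm 𝒮ℒ w) (B : ModularForm 𝒮ℒ (w - 2)) :
    IsHolomorphicAtCusp (⇑A + E2 * ⇑B) :=
  A.isHolomorphicAtCusp.add (isHolomorphicAtCusp_E2.mul B.isHolomorphicAtCusp)

theorem isQuasimodularForm_add_E2_mul (A : ModularForm 𝒮ℒ w) {B : ModularForm 𝒮ℒ (w - 2)}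
    (hB : B ≠ 0) : IsQuasimodularForm w 1 (⇑A + E2 * ⇑B) := by
  have hX := isHolomorphicAtCusp_add_E2_mul A B
  have hB' := B.isHolomorphicAtCusp.smul (6 / (Real.pi * Complex.I))
  refine ⟨hX.holo, ![⇑A + E2 * ⇑B, (6 / (Real.pi * Complex.I) : ℂ) • ⇑B], ?_, ?_, ?_, ?_⟩
  · exact Fin.forall_fin_two.mpr ⟨hX.holo, hB'.holo⟩
  · exact Fin.forall_fin_two.mpr ⟨hX.bdd, hB'.bdd⟩
  · have hpi : (Real.pi : ℂ) ≠ 0 := mod_cast Real.pi_ne_zero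
    refine smul_ne_zero (by simp [hpi]) fun h ↦ hB (DFunLike.coe_injective h)
  · intro γ z
    rw [slash_add_E2_mul]
    simp [Fin.sum_univ_two]

/-- Quasimodular forms of depth one are of the form `A + E₂ B` with `A`, `B` modular. -/
theorem IsQuasimodularForm.exists_eq_add_E2_mul {F : ℍ → ℂ} (hF : IsQuasimodularForm w 1 F) :
    ∃ (A : ModularForm 𝒮ℒ w) (B : ModularForm 𝒮ℒ (w - 2)), B ≠ 0 ∧ F = ⇑A + E2 * ⇑B := by
  obtain ⟨hhol, f, hf, hbdd, hne, hslash⟩ := hF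
  have hpi : (Real.pi : ℂ) ≠ 0 := mod_cast Real.pi_ne_zero
  have hF0 : F = f 0 := by
    ext z
    simpa [Fin.sum_univ_two] using hslash 1 z
  have hγ (γ : SL(2, ℤ)) (z : ℍ) :
      (F ∣[w] γ) z = F z + f 1 z * (((γ 1 0 : ℤ) : ℂ) / denom γ z) := by
    simpa [Fin.sum_univ_two, ← hF0] using hslash γ z
  have hS (z : ℍ) : F (S • z) = (z : ℂ) ^ w * (F z + f 1 z / z) := by
    have := hγ S z
    rw [slash_S_apply, denom_S] at this
    have hz : (z : ℂ) ^ w ≠ 0 := zpow_ne_zero _ (ne_zero z)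
    field_simp at this ⊢
    rw [this]
    simp [S]
  have hT (z : ℍ) : F (T • z) = F z := by
    have := hγ T z
    rw [slash_T_apply] at this
    simpa [T] using this
  have hST (z : ℍ) : F (S • T • z) = (T • z : ℍ) ^ w * (F z + f 1 z / (T • z : ℍ)) := by
    have h := hγ (S * T) z
    have hd : denom ((S * T : SL(2, ℤ)) : GL (Fin 2) ℝ) z = (T • z : ℍ) := by
      rw [ModularGroup.denom_apply, modular_T_smul, coe_vadd]
      simp [coe_S, coe_T, Matrix.mul_apply, Fin.sum_univ_two, add_comm]
    have h10 : ((S * T : SL(2, ℤ)) 1 0 : ℤ) = 1 := by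
      simp [coe_S, coe_T, Matrix.mul_apply, Fin.sum_univ_two]
    rw [ModularForm.SL_slash_apply, hd, h10, mul_smul, zpow_neg] at h
    have h2 := zpow_ne_zero w (ne_zero (T • z))
    rw [mul_inv_eq_iff_eq_mul₀ h2] at h
    rw [h, Int.cast_one, mul_comm, mul_one_div]
  -- F(STz) is computed twice: by the law of S at Tz and by the law of ST, whose lower row is (1,
  -- 1), at z.
  have h1T : f 1 ∣[w - 2] T = f 1 := by
    ext z
    rw [slash_T_apply]
    have h := hS (T • z)
    rw [hT, hST] at h
    have h1 : ((T • z : ℍ) : ℂ) ≠ 0 := ne_zero _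
    have h3 := add_left_cancel (mul_left_cancel₀ (zpow_ne_zero w h1) h)
    exact ((div_left_inj' h1).mp h3).symm
  have h1S : f 1 ∣[w - 2] S = f 1 := by
    ext z
    have hz := ne_zero z
    have hSz (z : ℍ) : ((S • z : ℍ) : ℂ) = -(z : ℂ)⁻¹ := by
      rw [modular_S_smul, coe_mk, inv_neg]
    have hSS : S • S • z = z := by
      ext1
      rw [hSz, hSz, inv_neg, inv_inv, neg_neg]
    -- The parity of w is not assumed here: -1 acts trivially with c = 0, which absorbs the sign
    -- produced by applying S twice.
    have h1 : F z * (-1 : ℂ) ^ w = F z := by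
      have hd : denom ((-1 : SL(2, ℤ)) : GL (Fin 2) ℝ) z = -1 := by
        rw [ModularGroup.denom_apply]
        simp
      have h := hγ (-1) z
      rw [ModularForm.SL_slash_apply, hd, ModularGroup.SL_neg_smul, one_smul, zpow_neg] at h
      rw [mul_inv_eq_iff_eq_mul₀ (zpow_ne_zero _ (by norm_num))] at h
      simpa using h.symm
    have h := hS (S • z)
    rw [hSS, hS z, hSz, neg_eq_neg_one_mul, mul_zpow, inv_zpow] at h
    have hw : (-1 : ℂ) ^ w ≠ 0 := zpow_ne_zero _ (by norm_num)
    have hzw : (z : ℂ) ^ w ≠ 0 := zpow_ne_zero _ hz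
    have h2 : (-1 : ℂ) ^ w * (f 1 z - f 1 (S • z) * ((z : ℂ) ^ w / z ^ (2 : ℤ))⁻¹) = 0 := by
      field_simp at h ⊢
      linear_combination (-(z : ℂ) ^ w * z) * h1 - h
    rw [slash_S_apply, zpow_sub₀ hz]
    exact (sub_eq_zero.mp ((mul_eq_zero.mp h2).resolve_left hw)).symm
  -- Scaled so that the defect of E₂B is that of F; the difference F - E₂B is then invariant.
  let B : ModularForm 𝒮ℒ (w - 2) := (Real.pi * Complex.I / 6 : ℂ) •
    ModularForm.ofSlashGenerators (f 1) (hf 1) (hbdd 1) h1S h1T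
  have hB (z : ℍ) : f 1 z = 6 / (Real.pi * Complex.I) * B z := by
    change f 1 z = 6 / (Real.pi * Complex.I) * (Real.pi * Complex.I / 6 * f 1 z)
    field_simp
  have hA (γ : SL(2, ℤ)) : (F - E2 * ⇑B) ∣[w] γ = F - E2 * ⇑B := by
    ext z
    have h0 := slash_add_E2_mul 0 B γ z
    rw [FunLike.coe_zero, zero_add] at h0
    rw [sub_eq_add_neg, SlashAction.add_slash, SlashAction.neg_slash, Pi.add_apply, Pi.neg_apply,
      h0, hγ, hB]
    simp only [Pi.add_apply, Pi.neg_apply, Pi.mul_apply]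
    ring
  have hEB := isHolomorphicAtCusp_E2.mul B.isHolomorphicAtCusp
  refine ⟨ModularForm.ofSlashGenerators (F - E2 * ⇑B) (hhol.sub hEB.holo)
    ((hF0 ▸ hbdd 0 : IsBoundedAtImInfty F).sub hEB.bdd) (hA S) (hA T), B, fun h ↦ hne ?_, ?_⟩
  · ext z
    change f 1 z = 0
    rw [hB, h]
    simp
  · exact (sub_add_cancel F (E2 * ⇑B)).symm

end DepthOne

/-! ### Behaviour under S and the modular Wronskian -/

section Transformation

open EisensteinSeries ModularGroup Derivative

variable {w : ℤ}

theorem ModularForm.apply_S_smul {k : ℤ} (f : ModularForm 𝒮ℒ k) (z : ℍ) :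
    f (S • z) = (z : ℂ) ^ k * f z := by
  have h := congrFun (f.slash_SL_eq S) z
  rwa [slash_S_apply, mul_inv_eq_iff_eq_mul₀ (zpow_ne_zero _ (ne_zero z)), mul_comm] at h

theorem normalizedDeriv_apply_S_smul {f : ℍ → ℂ} (hf : MDifferentiable 𝓘(ℂ) 𝓘(ℂ) f) (k : ℤ)
    (z : ℍ) :
    normalizedDerivOfComplex f (S • z) = (z : ℂ) ^ (k + 2) *
      (normalizedDerivOfComplex (f ∣[k] S) z +
        k * (2 * Real.pi * Complex.I)⁻¹ * (1 / z) * (f ∣[k] S) z) := by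
  have h := congrFun (normalizedDerivOfComplex_SL_slash (k := k) hf (γ := S)) z
  rw [Pi.sub_apply, slash_S_apply, denom_S, eq_sub_iff_add_eq,
    eq_mul_inv_iff_mul_eq₀ (zpow_ne_zero _ (ne_zero z))] at h
  rw [← h, mul_comm]
  simp [S]

theorem ModularForm.normalizedDeriv_apply_S_smul {k : ℤ} (f : ModularForm 𝒮ℒ k) (z : ℍ) :
    normalizedDerivOfComplex f (S • z) = (z : ℂ) ^ (k + 2) *
      (normalizedDerivOfComplex f z + k * (2 * Real.pi * Complex.I)⁻¹ * (1 / z) * f z) := by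
  rw [_root_.normalizedDeriv_apply_S_smul (ModularFormClass.holo f) k, f.slash_SL_eq]

theorem slash_S_add_E2_mul (A : ModularForm 𝒮ℒ w) (B : ModularForm 𝒮ℒ (w - 2)) :
    (⇑A + E2 * ⇑B) ∣[w] S =
      (⇑A + E2 * ⇑B) + ((6 / (Real.pi * Complex.I) : ℂ) • ⇑B) * fun z : ℍ ↦ (z : ℂ)⁻¹ := by
  ext z
  rw [slash_add_E2_mul, denom_S]
  simp [S, mul_assoc]

theorem add_E2_mul_apply_S_smul (A : ModularForm 𝒮ℒ w) (B : ModularForm 𝒮ℒ (w - 2)) (z : ℍ) :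
    (⇑A + E2 * ⇑B) (S • z) =
      (z : ℂ) ^ w * ((⇑A + E2 * ⇑B) z + 6 / (Real.pi * Complex.I) * B z * (z : ℂ)⁻¹) := by
  have h := congrFun (slash_S_add_E2_mul A B) z
  rw [slash_S_apply, mul_inv_eq_iff_eq_mul₀ (zpow_ne_zero _ (ne_zero z))] at h
  rw [h, mul_comm]
  rfl

theorem mdifferentiable_inv_coe : MDifferentiable 𝓘(ℂ) 𝓘(ℂ) (fun z : ℍ ↦ (z : ℂ)⁻¹) := by
  rw [UpperHalfPlane.mdifferentiable_iff]
  refine (differentiableOn_inv.mono fun z hz ↦ ?_).congr fun z hz ↦ ?_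
  · rintro rfl
    simp at hz
  · simp [ofComplex_apply_of_im_pos hz]

theorem normalizedDeriv_inv_coe (z : ℍ) :
    normalizedDerivOfComplex (fun z : ℍ ↦ (z : ℂ)⁻¹) z =
      -((2 * Real.pi * Complex.I)⁻¹ * ((z : ℂ) ^ 2)⁻¹) := by
  have heq : ((fun z : ℍ ↦ (z : ℂ)⁻¹) ∘ ofComplex) =ᶠ[𝓝 (z : ℂ)] fun w : ℂ ↦ w⁻¹ := by
    filter_upwards [isOpen_upperHalfPlaneSet.mem_nhds z.im_pos] with w hw
    simp [ofComplex_apply_of_im_pos hw]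
  rw [normalizedDerivOfComplex, heq.deriv_eq, deriv_inv, mul_neg]

/-- The factor w - 1 is w from the automorphy factor less 1 from differentiating 1/z; it becomes the
denominator of the limit of the quotient. -/
theorem normalizedDeriv_add_E2_mul_apply_S_smul (A : ModularForm 𝒮ℒ w)
    (B : ModularForm 𝒮ℒ (w - 2)) (z : ℍ) :
    normalizedDerivOfComplex (⇑A + E2 * ⇑B) (S • z) = (z : ℂ) ^ (w + 2) *
      (normalizedDerivOfComplex (⇑A + E2 * ⇑B) z +
        6 / (Real.pi * Complex.I) * normalizedDerivOfComplex B z * (z : ℂ)⁻¹ +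
        w * (2 * Real.pi * Complex.I)⁻¹ * (⇑A + E2 * ⇑B) z * (z : ℂ)⁻¹ +
        (w - 1) * (2 * Real.pi * Complex.I)⁻¹ * (6 / (Real.pi * Complex.I)) * B z *
          ((z : ℂ) ^ 2)⁻¹) := by
  have hX := (isHolomorphicAtCusp_add_E2_mul A B).holo
  have hB := ModularFormClass.holo B
  have hkB : MDifferentiable 𝓘(ℂ) 𝓘(ℂ) ((6 / (Real.pi * Complex.I) : ℂ) • ⇑B) := hB.const_smul _
  rw [normalizedDeriv_apply_S_smul hX w, slash_S_add_E2_mul,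
    normalizedDerivOfComplex_add _ _ hX (hkB.mul mdifferentiable_inv_coe),
    normalizedDerivOfComplex_mul _ _ hkB mdifferentiable_inv_coe,
    normalizedDerivOfComplex_smul _ _ hB]
  simp only [Pi.add_apply, Pi.mul_apply, Pi.smul_apply, normalizedDeriv_inv_coe, smul_eq_mul]
  have hz := ne_zero z
  field_simp
  ring

/-- The Wronskian of the vector-valued form attached to `X = A + E₂ B`, a modular form of
weight `2 w`. -/
noncomputable def depthOneWronskian (A : ModularForm 𝒮ℒ w) (B : ModularForm 𝒮ℒ (w - 2)) :
    ℍ → ℂ :=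
  (⇑A + E2 * ⇑B) * (⇑A + E2 * ⇑B) + (12 : ℂ) •
    ((⇑A + E2 * ⇑B) * normalizedDerivOfComplex B - ⇑B * normalizedDerivOfComplex (⇑A + E2 * ⇑B))

theorem isHolomorphicAtCusp_depthOneWronskian (A : ModularForm 𝒮ℒ w)
    (B : ModularForm 𝒮ℒ (w - 2)) : IsHolomorphicAtCusp (depthOneWronskian A B) := by
  have hX := isHolomorphicAtCusp_add_E2_mul A B
  have hB := B.isHolomorphicAtCusp
  exact (hX.mul hX).add (((hX.mul hB.normalizedDeriv).sub (hB.mul hX.normalizedDeriv)).smul _)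

/-- Under S the square contributes the extra terms 2κXB/z + κ²B²/z², with κ = 6/(πi). The bracket
XB' - BX' contributes -(2XB/z + κB²/z²)/(2πi), and 12/(2πi) = κ makes them cancel. -/
theorem depthOneWronskian_slash_S (A : ModularForm 𝒮ℒ w) (B : ModularForm 𝒮ℒ (w - 2)) :
    depthOneWronskian A B ∣[w + w] S = depthOneWronskian A B := by
  ext z
  have hz := ne_zero z
  have hw : (z : ℂ) ^ w ≠ 0 := zpow_ne_zero _ hz
  have hpi : (Real.pi : ℂ) ≠ 0 := mod_cast Real.pi_ne_zero
  rw [slash_S_apply, mul_inv_eq_iff_eq_mul₀ (zpow_ne_zero _ hz)]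
  simp only [depthOneWronskian, Pi.add_apply (_ * _), Pi.mul_apply (_ + _), Pi.smul_apply,
    Pi.sub_apply, Pi.mul_apply (⇑B), add_E2_mul_apply_S_smul, ModularForm.apply_S_smul,
    ModularForm.normalizedDeriv_apply_S_smul, normalizedDeriv_add_E2_mul_apply_S_smul, smul_eq_mul]
  generalize (⇑A + E2 * ⇑B) z = x
  generalize normalizedDerivOfComplex (⇑A + E2 * ⇑B) z = dx
  generalize normalizedDerivOfComplex (⇑B) z = db
  generalize B z = b
  rw [sub_add_cancel, zpow_add₀ hz, zpow_add₀ hz, zpow_sub₀ hz]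
  generalize (z : ℂ) ^ w = p at *
  push_cast
  field_simp
  ring

end Transformation

/-! ### Leading coefficients of power series -/

section PowerSeries

open PowerSeries

theorem PowerSeries.coeff_mul_of_X_pow_dvd {R : Type*} [CommRing R] {f g : PowerSeries R}
    {m n : ℕ} (hf : X ^ m ∣ f) (hg : X ^ n ∣ g) :
    coeff (m + n) (f * g) = coeff m f * coeff n g := by
  obtain ⟨f, rfl⟩ := hf
  obtain ⟨g, rfl⟩ := hg
  rw [show X ^ m * f * (X ^ n * g) = X ^ (m + n) * (f * g) by ring]
  simp [coeff_X_pow_mul']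

theorem PowerSeries.X_pow_dvd_of_order_eq {R : Type*} [CommRing R] {f : PowerSeries R} {n : ℕ}
    (hf : f.order = n) : X ^ n ∣ f :=
  X_pow_dvd_iff.mpr fun _ hm ↦ coeff_of_lt_order _ (by rw [hf]; exact_mod_cast hm)

theorem PowerSeries.coeff_ne_zero_of_order_eq {R : Type*} [CommRing R] {f : PowerSeries R} {n : ℕ}
    (hf : f.order = n) : coeff n f ≠ 0 :=
  (order_eq_nat.mp hf).1

end PowerSeries

/-! ### Vanishing orders of extremal forms -/

section Extremal

open EisensteinSeries Derivative

theorem IsHolomorphicAtCusp.X_pow_dvd_qExpansion_normalizedDeriv {f : ℍ → ℂ}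
    (hf : IsHolomorphicAtCusp f) {n : ℕ} (h : PowerSeries.X ^ n ∣ qExpansion 1 f) :
    PowerSeries.X ^ n ∣ qExpansion 1 (normalizedDerivOfComplex f) := by
  rw [PowerSeries.X_pow_dvd_iff] at h ⊢
  intro m hm
  rw [hf.coeff_qExpansion_normalizedDeriv, h m hm, mul_zero]

/-- Since X² starts at q^(2n), beyond q^(n+b), the Wronskian has leading coefficient 12(b - n) times
those of X and B. This is nonzero, so the Sturm bound in weight 2w applies. -/
theorem order_add_order_le {w : ℤ} (A : ModularForm 𝒮ℒ w) (B : ModularForm 𝒮ℒ (w - 2))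
    {n b : ℕ} (hn : (qExpansion 1 (⇑A + E2 * ⇑B)).order = n) (hb : (qExpansion 1 B).order = b)
    (hlt : b < n) : n + b ≤ (w + w).toNat / 12 := by
  have hX := isHolomorphicAtCusp_add_E2_mul A B
  have hB := B.isHolomorphicAtCusp
  have hXdvd := PowerSeries.X_pow_dvd_of_order_eq hn
  have hBdvd := PowerSeries.X_pow_dvd_of_order_eq hb
  have hDX := hX.X_pow_dvd_qExpansion_normalizedDeriv hXdvd
  have hDB := hB.X_pow_dvd_qExpansion_normalizedDeriv hBdvd
  have hW := isHolomorphicAtCusp_depthOneWronskian A B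
  have hexp : qExpansion 1 (depthOneWronskian A B) =
      qExpansion 1 (⇑A + E2 * ⇑B) * qExpansion 1 (⇑A + E2 * ⇑B) + (12 : ℂ) •
        (qExpansion 1 (⇑A + E2 * ⇑B) * qExpansion 1 (normalizedDerivOfComplex B) -
          qExpansion 1 B * qExpansion 1 (normalizedDerivOfComplex (⇑A + E2 * ⇑B))) := by
    have h1 := hX.mul hB.normalizedDeriv
    have h2 := hB.mul hX.normalizedDeriv
    rw [depthOneWronskian, (hX.mul hX).qExpansion_add ((h1.sub h2).smul 12), hX.qExpansion_mul hX,
      (h1.sub h2).qExpansion_smul, h1.qExpansion_sub h2, hX.qExpansion_mul hB.normalizedDeriv,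
      hB.qExpansion_mul hX.normalizedDeriv]
  have hsq : PowerSeries.X ^ (n + b + 1) ∣
      qExpansion 1 (⇑A + E2 * ⇑B) * qExpansion 1 (⇑A + E2 * ⇑B) :=
    (pow_dvd_pow _ (by lia)).trans (pow_add (PowerSeries.X (R := ℂ)) n n ▸ mul_dvd_mul hXdvd hXdvd)
  have hcoeff : (qExpansion 1 (depthOneWronskian A B)).coeff (n + b) ≠ 0 := by
    have h1 := PowerSeries.coeff_mul_of_X_pow_dvd hXdvd hDB
    have h2 := PowerSeries.coeff_mul_of_X_pow_dvd hBdvd hDX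
    rw [add_comm b n] at h2
    have hval : (qExpansion 1 (depthOneWronskian A B)).coeff (n + b) =
        12 * ((b : ℂ) - n) * ((qExpansion 1 (⇑A + E2 * ⇑B)).coeff n *
          (qExpansion 1 B).coeff b) := by
      rw [hexp, map_add, PowerSeries.X_pow_dvd_iff.mp hsq _ (Nat.lt_succ_self _),
        PowerSeries.coeff_smul, map_sub, h1, h2, hB.coeff_qExpansion_normalizedDeriv,
        hX.coeff_qExpansion_normalizedDeriv]
      ring
    rw [hval]
    have hne : (b : ℂ) - n ≠ 0 := sub_ne_zero.mpr (by exact_mod_cast hlt.ne)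
    exact mul_ne_zero (mul_ne_zero (by norm_num) hne) (mul_ne_zero
      (PowerSeries.coeff_ne_zero_of_order_eq hn) (PowerSeries.coeff_ne_zero_of_order_eq hb))
  have hdvd : PowerSeries.X ^ (n + b) ∣ qExpansion 1 (depthOneWronskian A B) := by
    rw [hexp]
    refine dvd_add ((pow_dvd_pow _ (Nat.le_succ _)).trans hsq) (dvd_smul_of_dvd _ (dvd_sub ?_ ?_))
    · exact pow_add (PowerSeries.X (R := ℂ)) n b ▸ mul_dvd_mul hXdvd hDB
    · exact add_comm b n ▸ pow_add (PowerSeries.X (R := ℂ)) b n ▸ mul_dvd_mul hBdvd hDX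
  let W : ModularForm 𝒮ℒ (w + w) := ModularForm.ofSlashGenerators _ hW.holo hW.bdd
    (depthOneWronskian_slash_S A B) (slash_T_eq_of_periodic hW.periodic _)
  by_contra! hlt'
  have hW0 : W = 0 := by
    refine ModularForm.sturm_bound_levelOne (lt_of_lt_of_le (Nat.cast_lt.mpr hlt') ?_)
    exact PowerSeries.nat_le_order _ _ fun i hi ↦ PowerSeries.X_pow_dvd_iff.mp hdvd i hi
  refine hcoeff ?_
  have : depthOneWronskian A B = 0 := congrArg DFunLike.coe hW0
  rw [this, qExpansion_zero, map_zero]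

theorem ModularForm.order_qExpansion_le {k : ℤ} {f : ModularForm 𝒮ℒ k} (hf : f ≠ 0) :
    (qExpansion 1 f).order ≤ (k.toNat / 12 : ℕ) :=
  not_lt.mp fun h ↦ hf (ModularForm.sturm_bound_levelOne h)

theorem ModularForm.finrank_levelOne (k : ℕ) (hk : Even k) :
    Module.finrank ℂ (ModularForm 𝒮ℒ (k : ℤ)) =
      if k ≡ 2 [MOD 12] then k / 12 else k / 12 + 1 := by
  refine Module.finrank_eq_of_rank_eq ?_
  rw [ModularForm.dimension_level_one k hk]

/-- The coefficients of `A + E₂ B` up to `N`, as a linear function of the pair `(A, B)`. -/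
noncomputable def coeffAddE2Mul (w : ℤ) (N : ℕ) :
    ModularForm 𝒮ℒ w × ModularForm 𝒮ℒ (w - 2) →ₗ[ℂ] (Fin N → ℂ) where
  toFun p i := (qExpansion 1 (⇑p.1 + E2 * ⇑p.2)).coeff i
  map_add' p q := by
    have h : ⇑(p + q).1 + E2 * ⇑(p + q).2 = (⇑p.1 + E2 * ⇑p.2) + (⇑q.1 + E2 * ⇑q.2) := by
      ext z
      simp
      ring
    ext i
    rw [h, (isHolomorphicAtCusp_add_E2_mul p.1 p.2).qExpansion_add
      (isHolomorphicAtCusp_add_E2_mul q.1 q.2), map_add]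
    rfl
  map_smul' c p := by
    have h : ⇑(c • p).1 + E2 * ⇑(c • p).2 = c • (⇑p.1 + E2 * ⇑p.2) := by
      ext z
      simp
      ring
    ext i
    rw [h, (isHolomorphicAtCusp_add_E2_mul p.1 p.2).qExpansion_smul, PowerSeries.coeff_smul]
    rfl

theorem exists_isQuasimodularForm_le_vanishingOrder {w : ℕ} (hw : 6 ≤ w) (hw_even : Even w) :
    ∃ G : ℍ → ℂ, IsQuasimodularForm w 1 G ∧ ((w / 6 : ℕ) : ℕ∞) ≤ vanishingOrder G := by
  -- The pairs (A, B) form a space of dimension ⌊w/6⌋ + 1, so some nonzero pair kills the first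
  -- ⌊w/6⌋ coefficients.
  have hdim : Module.finrank ℂ (Fin (w / 6) → ℂ) <
      Module.finrank ℂ (ModularForm 𝒮ℒ (w : ℤ) × ModularForm 𝒮ℒ ((w : ℤ) - 2)) := by
    rw [Module.finrank_prod, show (w : ℤ) - 2 = ((w - 2 : ℕ) : ℤ) by lia,
      ModularForm.finrank_levelOne w hw_even, ModularForm.finrank_levelOne (w - 2) (by grind)]
    simp only [Module.finrank_fin_fun, Nat.ModEq]
    split_ifs <;> grind
  obtain ⟨⟨A, B⟩, hker, hne⟩ := Submodule.exists_mem_ne_zero_of_ne_bot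
    (LinearMap.ker_ne_bot_of_finrank_lt (f := coeffAddE2Mul w (w / 6)) hdim)
  have horder : ((w / 6 : ℕ) : ℕ∞) ≤ (qExpansion 1 (⇑A + E2 * ⇑B)).order :=
    PowerSeries.nat_le_order _ _ fun i hi ↦ congrFun (LinearMap.mem_ker.mp hker) ⟨i, hi⟩
  refine ⟨⇑A + E2 * ⇑B, isQuasimodularForm_add_E2_mul A ?_, horder⟩
  -- If B = 0, then A would be a nonzero modular form of order at least ⌊w/6⌋ > ⌊w/12⌋.
  rintro rfl
  have hA : A ≠ 0 := fun h ↦ hne (by rw [h]; rfl)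
  rw [FunLike.coe_zero, mul_zero, add_zero] at horder
  have h := horder.trans (ModularForm.order_qExpansion_le hA)
  rw [Nat.cast_le] at h
  lia

/-- For a normalized extremal form `A + E₂ B` of depth one, `A + E₂ B` vanishes at the cusp and
`B` does not. -/
theorem coeff_zero_of_isNormalizedExtremalQuasimodularForm {w : ℕ} (hw : 6 ≤ w) (hw_even : Even w)
    (A : ModularForm 𝒮ℒ (w : ℤ)) {B : ModularForm 𝒮ℒ ((w : ℤ) - 2)} (hB : B ≠ 0)
    (hX : IsNormalizedExtremalQuasimodularForm w 1 (⇑A + E2 * ⇑B)) :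
    (qExpansion 1 (⇑A + E2 * ⇑B)).coeff 0 = 0 ∧ (qExpansion 1 B).coeff 0 ≠ 0 := by
  obtain ⟨G, hG, hGord⟩ := exists_isQuasimodularForm_le_vanishingOrder hw hw_even
  have hle : ((w / 6 : ℕ) : ℕ∞) ≤ (qExpansion 1 (⇑A + E2 * ⇑B)).order :=
    hGord.trans (hX.1.2 G hG)
  refine ⟨PowerSeries.coeff_of_lt_order _ (lt_of_lt_of_le ?_ hle), ?_⟩
  · exact_mod_cast (by lia : 0 < w / 6)
  have hBord := ModularForm.order_qExpansion_le hB
  obtain ⟨b, hb⟩ := ENat.ne_top_iff_exists.mp (ne_top_of_le_ne_top (ENat.natCast_ne_top _) hBord)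
  obtain ⟨n, hn, -⟩ := hX.2
  rw [vanishingOrder] at hn
  rw [← hb] at hBord
  rw [hn] at hle
  have hBord' : b ≤ ((w : ℤ) - 2).toNat / 12 := by exact_mod_cast hBord
  have hle' : w / 6 ≤ n := by exact_mod_cast hle
  -- Here b ≤ ⌊(w - 2)/12⌋ < ⌊w/6⌋ ≤ n, where w ≥ 6 is needed.
  have h := order_add_order_le A B hn hb.symm (by lia)
  obtain rfl : b = 0 := by lia
  exact PowerSeries.coeff_ne_zero_of_order_eq hb.symm

end Extremal

/-! ### Limits along the imaginary axis -/

section Asymptotics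

open EisensteinSeries Derivative

theorem coe_ofComplex_I_mul {y : ℝ} (hy : 0 < y) :
    (ofComplex (Complex.I * y) : ℂ) = Complex.I * y := by
  rw [ofComplex_apply_of_im_pos (by simpa using hy)]

theorem ofComplex_I_mul_eq_S_smul {t : ℝ} (ht : 0 < t) :
    ofComplex (Complex.I * t) = ModularGroup.S • ofComplex (Complex.I * (t⁻¹ : ℝ)) := by
  ext1
  have h := coe_ofComplex_I_mul (inv_pos.mpr ht)
  simp only [modular_S_smul, coe_mk, coe_ofComplex_I_mul ht, h]
  have : (t : ℂ) ≠ 0 := mod_cast ht.ne'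
  push_cast
  field_simp
  simp

/-- Trades t → 0⁺ for y = 1/t → ∞ through it = S(iy). -/
theorem tendsto_nhdsGT_zero_of_S_smul {g : ℝ → ℍ → ℂ} {h : ℝ → ℂ} {L : ℂ}
    (hh : Tendsto h atTop (𝓝 L))
    (hg : ∀ y : ℝ, 0 < y → g y⁻¹ (ModularGroup.S • ofComplex (Complex.I * y)) = h y) :
    Tendsto (fun t : ℝ ↦ g t (ofComplex (Complex.I * t))) (𝓝[>] 0) (𝓝 L) := by
  refine (hh.comp tendsto_inv_nhdsGT_zero).congr' ?_
  filter_upwards [self_mem_nhdsWithin] with t ht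
  rw [Function.comp_apply, ← hg _ (inv_pos.mpr ht), inv_inv, ← ofComplex_I_mul_eq_S_smul ht]

theorem eventually_im_ofComplex_I_mul :
    ∀ᶠ y : ℝ in atTop, (ofComplex (Complex.I * y)).im = y := by
  filter_upwards [eventually_gt_atTop 0] with y hy
  rw [← coe_im, coe_ofComplex_I_mul hy]
  simp

theorem IsHolomorphicAtCusp.tendsto_ofComplex_I_mul {f : ℍ → ℂ} (hf : IsHolomorphicAtCusp f) :
    Tendsto (fun y : ℝ ↦ f (ofComplex (Complex.I * y))) atTop (𝓝 ((qExpansion 1 f).coeff 0)) :=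
  hf.tendsto_atImInfty.comp <| tendsto_comap_iff.mpr <|
    tendsto_id.congr' (eventually_im_ofComplex_I_mul.mono fun _ h ↦ h.symm)

variable {w : ℕ} (A : ModularForm 𝒮ℒ (w : ℤ)) (B : ModularForm 𝒮ℒ ((w : ℤ) - 2))

/-- The function is y times the bracket in the S-law at z = iy; both limits use it. -/
theorem tendsto_mul_add_E2_mul (h0 : (qExpansion 1 (⇑A + E2 * ⇑B)).coeff 0 = 0) :
    Tendsto (fun y : ℝ ↦ y * (⇑A + E2 * ⇑B) (ofComplex (Complex.I * y)) +
      6 / (Real.pi * Complex.I) * B (ofComplex (Complex.I * y)) / Complex.I) atTop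
      (𝓝 (6 / (Real.pi * Complex.I) * (qExpansion 1 B).coeff 0 / Complex.I)) := by
  have h1 := (isHolomorphicAtCusp_add_E2_mul A B).tendsto_pow_mul h0 1
    eventually_im_ofComplex_I_mul
  have h2 := (B.isHolomorphicAtCusp.tendsto_ofComplex_I_mul.const_mul
    (6 / (Real.pi * Complex.I))).div_const Complex.I
  simpa using h1.add h2

theorem tendsto_pow_mul_add_E2_mul (hw : 1 ≤ w) (hw_even : Even w)
    (h0 : (qExpansion 1 (⇑A + E2 * ⇑B)).coeff 0 = 0) :
    Tendsto (fun t : ℝ ↦ (t : ℂ) ^ (w - 1) * (⇑A + E2 * ⇑B) (ofComplex (Complex.I * t)))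
      (𝓝[>] 0)
      (𝓝 (-(6 * (-1 : ℂ) ^ (w / 2) * (qExpansion 1 B).coeff 0 / (Real.pi : ℂ)))) := by
  have hpi : (Real.pi : ℂ) ≠ 0 := mod_cast Real.pi_ne_zero
  have hI : Complex.I ^ w = (-1) ^ (w / 2) := by
    rw [← Complex.I_sq, ← pow_mul, Nat.mul_div_cancel' hw_even.two_dvd]
  refine tendsto_nhdsGT_zero_of_S_smul (g := fun t z ↦ (t : ℂ) ^ (w - 1) * (⇑A + E2 * ⇑B) z) ?_
    (fun y hy ↦ ?_) (h := fun y : ℝ ↦ Complex.I ^ w *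
      (y * (⇑A + E2 * ⇑B) (ofComplex (Complex.I * y)) +
        6 / (Real.pi * Complex.I) * B (ofComplex (Complex.I * y)) / Complex.I))
  · convert! (tendsto_mul_add_E2_mul A B h0).const_mul (Complex.I ^ w) using 2
    rw [hI]
    field_simp
    rw [Complex.I_sq]
    ring
  · have hy' : (y : ℂ) ≠ 0 := mod_cast hy.ne'
    obtain ⟨v, rfl⟩ := Nat.exists_eq_add_of_le' hw
    rw [add_E2_mul_apply_S_smul, coe_ofComplex_I_mul hy, zpow_natCast]
    push_cast
    rw [inv_pow, mul_pow, pow_succ (y : ℂ)]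
    field_simp

theorem tendsto_div_mul_normalizedDeriv_add_E2_mul (hw : 2 ≤ w)
    (h0 : (qExpansion 1 (⇑A + E2 * ⇑B)).coeff 0 = 0) (hB : (qExpansion 1 B).coeff 0 ≠ 0) :
    Tendsto (fun t : ℝ ↦ (⇑A + E2 * ⇑B) (ofComplex (Complex.I * t)) /
        (t * normalizedDerivOfComplex (⇑A + E2 * ⇑B) (ofComplex (Complex.I * t))))
      (𝓝[>] 0) (𝓝 (2 * (Real.pi : ℂ) / ((w : ℂ) - 1))) := by
  have hpi : (Real.pi : ℂ) ≠ 0 := mod_cast Real.pi_ne_zero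
  have hw1 : (w : ℂ) - 1 ≠ 0 := sub_ne_zero.mpr (by norm_cast; lia)
  have hXc := isHolomorphicAtCusp_add_E2_mul A B
  have hBc := B.isHolomorphicAtCusp
  have hdX := hXc.normalizedDeriv.tendsto_pow_mul
    (by rw [hXc.coeff_qExpansion_normalizedDeriv, Nat.cast_zero, zero_mul]) 2
    eventually_im_ofComplex_I_mul
  have hdB := hBc.normalizedDeriv.tendsto_pow_mul
    (by rw [hBc.coeff_qExpansion_normalizedDeriv, Nat.cast_zero, zero_mul]) 1
    eventually_im_ofComplex_I_mul
  have hX1 := hXc.tendsto_pow_mul h0 1 eventually_im_ofComplex_I_mul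
  -- This is y² times the bracket in the S-law of X' at z = iy. The last term is subtracted because
  -- z⁻² = -y⁻², and only it survives.
  have hden := ((hdX.add (hdB.const_mul (6 / (Real.pi * Complex.I) / Complex.I))).add
    (hX1.const_mul (w * (2 * Real.pi * Complex.I)⁻¹ / Complex.I))).sub
    (hBc.tendsto_ofComplex_I_mul.const_mul
      ((w - 1) * (2 * Real.pi * Complex.I)⁻¹ * (6 / (Real.pi * Complex.I))))
  rw [mul_zero, mul_zero, add_zero, add_zero, zero_sub] at hden
  have hlim := (tendsto_mul_add_E2_mul A B h0).div hden.neg (by simpa [hpi, hw1] using hB)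
  have hval : 2 * (Real.pi : ℂ) / ((w : ℂ) - 1) =
      6 / (Real.pi * Complex.I) * (qExpansion 1 B).coeff 0 / Complex.I /
        (- -((w - 1) * (2 * Real.pi * Complex.I)⁻¹ * (6 / (Real.pi * Complex.I)) *
          (qExpansion 1 B).coeff 0)) := by
    rw [neg_neg]
    field_simp
  rw [← hval] at hlim
  refine tendsto_nhdsGT_zero_of_S_smul (g := fun t z ↦ (⇑A + E2 * ⇑B) z /
    (t * normalizedDerivOfComplex (⇑A + E2 * ⇑B) z)) hlim fun y hy ↦ ?_
  have hy' : (y : ℂ) ≠ 0 := mod_cast hy.ne'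
  -- The factor common to numerator and denominator; the remaining (iy)² = -y² accounts for
  -- `hden.neg`.
  have hp : (Complex.I * y : ℂ) ^ (w : ℤ) / y ≠ 0 :=
    div_ne_zero (zpow_ne_zero _ (mul_ne_zero Complex.I_ne_zero hy')) hy'
  rw [add_E2_mul_apply_S_smul, normalizedDeriv_add_E2_mul_apply_S_smul, coe_ofComplex_I_mul hy,
    Pi.div_apply, zpow_add₀ (mul_ne_zero Complex.I_ne_zero hy')]
  refine Eq.trans ?_ (mul_div_mul_left _ _ hp)
  congr 1
  · field_simp
  · push_cast
    field_simp
    simp only [Complex.I_sq]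
    ring

end Asymptotics

theorem mainTheorem5 (w : ℕ) (hw : 6 ≤ w) (hw_even : Even w) (X : ℍ → ℂ)
    (hX : IsNormalizedExtremalQuasimodularForm (w : ℤ) 1 X) :
    Tendsto (fun t : ℝ =>
        X (ofComplex (Complex.I * (t : ℂ))) /
          ((t : ℂ) * Derivative.normalizedDerivOfComplex X (ofComplex (Complex.I * (t : ℂ)))))
      (𝓝[>] (0 : ℝ)) (𝓝 (2 * (Real.pi : ℂ) / ((w : ℂ) - 1))) ∧
    (∃ (A : ModularForm 𝒮ℒ (w : ℤ)) (B : ModularForm 𝒮ℒ ((w : ℤ) - 2)),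
      ∀ z : ℍ, X z = A z + EisensteinSeries.E2 z * B z) ∧
    (∀ (A : ModularForm 𝒮ℒ (w : ℤ)) (B : ModularForm 𝒮ℒ ((w : ℤ) - 2)),
      (∀ z : ℍ, X z = A z + EisensteinSeries.E2 z * B z) →
      Tendsto (fun t : ℝ => (t : ℂ) ^ (w - 1) * X (ofComplex (Complex.I * (t : ℂ))))
        (𝓝[>] (0 : ℝ))
        (𝓝 (-(6 * (-1 : ℂ) ^ (w / 2) * (qExpansion 1 B).coeff 0 / (Real.pi : ℂ))))) := by
  obtain ⟨A, B, hB, rfl⟩ := hX.1.1.exists_eq_add_E2_mul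
  obtain ⟨h0, hB0⟩ := coeff_zero_of_isNormalizedExtremalQuasimodularForm hw hw_even A hB hX
  refine ⟨tendsto_div_mul_normalizedDeriv_add_E2_mul A B (by lia) h0 hB0,
    ⟨A, B, fun z ↦ rfl⟩, fun A' B' h ↦ ?_⟩
  -- Uniqueness of the decomposition is not needed: the second limit requires only that X vanish at
  -- the cusp.
  have h' : ⇑A + EisensteinSeries.E2 * ⇑B = ⇑A' + EisensteinSeries.E2 * ⇑B' := funext h
  rw [h'] at h0 ⊢
  exact tendsto_pow_mul_add_E2_mul A' B' (by lia) hw_even h0
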